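/- Let $m\ge 1$, let $|\cdot|$ be the Euclidean norm on $\mathbb{C}^m$, let $D=\{z\in\mathbb{C}^m:\max_j|z_j|<1\}$ be the unit polydisk and $B=\{z\in\mathbb{C}^m:|z|<1\}$ the unit ball. For $U\in\{D,B\}$, a holomorphic map $F:U\to\mathbb{C}^m$ is called a Wu $K$-mapping if $\|F'(z)\|\le K\,|\det F'(z)|^{1/m}$ for all $z\in U$, where $\|\cdot\|$ is the operator norm associated with $|\cdot|$. We say that $F$ covers a schlicht ball of radius $R$ if there is a subdomain (connected open subset) $\Omega\subset U$ on which $F$ is one to one and whose image $F(\Omega)$ contains an open Euclidean ball of radius $R$. There is a constant $C(m)>0$, depending only on $m$, such that every Wu $K$-mapping $F:D\to\mathbb{C}^m$ with $|\det F'(0)|=1$ covers a schlicht ball of radius $C(m)/K^{\frac32 m-\frac12}$, and every Wu $K$-mapping $F:B\to\mathbb{C}^m$ with $|\det F'(0)|=1$ covers a schlicht ball of radius $m^{-1/2}\,C(m)/K^{\frac32 m-\frac12}$. Explicitly, for every $\sigma\in(0,1)$ and every $\gamma>1$, both assertions hold with the positive constant $$C(m)=\frac{\sigma(1-\sigma)}{(2-\sigma)\,2^m}\cdot\frac{1}{\gamma}\exp\left(-\frac{1}{\gamma-1}+\frac12\,\frac{1}{\gamma^2-1}-\frac13\,\frac{1}{\gamma^3-1}\right).$$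 -/

import Mathlib

namespace BlochWu

noncomputable section

/-- The open polydisk `D(c, r)` in `ℂ^m`: all points `z` with `max_j |z_j - c_j| < r`. -/
def polydisk {m : ℕ} (c : EuclideanSpace ℂ (Fin m)) (r : ℝ) : Set (EuclideanSpace ℂ (Fin m)) :=
  {z | ∀ j, ‖z j - c j‖ < r}

/-- `F` is a Wu `K`-mapping on `U`: it is holomorphic on `U` and
`‖F'(z)‖ ≤ K |det F'(z)|^{1/m}` for all `z ∈ U`, where `‖·‖` is the operator norm with respect to
the Euclidean norm of `ℂ^m` and `det` is the complex determinant. -/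
def IsWuMapping {m : ℕ} (K : ℝ) (U : Set (EuclideanSpace ℂ (Fin m)))
    (F : EuclideanSpace ℂ (Fin m) → EuclideanSpace ℂ (Fin m)) : Prop :=
  DifferentiableOn ℂ F U ∧
    ∀ z ∈ U, ‖fderiv ℂ F z‖ ≤ K * ‖(fderiv ℂ F z).det‖ ^ (1 / (m : ℝ))

/-- A Wu `K`-mapping on `U` with the normalisation `|det F'(0)| = 1`. -/
def IsNormalisedWuMapping {m : ℕ} (K : ℝ) (U : Set (EuclideanSpace ℂ (Fin m)))
    (F : EuclideanSpace ℂ (Fin m) → EuclideanSpace ℂ (Fin m)) : Prop :=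
  IsWuMapping K U F ∧ ‖(fderiv ℂ F 0).det‖ = 1

/-- `F`, defined on `U`, covers a schlicht ball of radius `R`: there is a subdomain (a connected
open subset) `Ω` of `U` on which `F` is one to one and whose image contains an open Euclidean ball
of radius `R`. -/
def CoversSchlichtBall {m : ℕ} (U : Set (EuclideanSpace ℂ (Fin m)))
    (F : EuclideanSpace ℂ (Fin m) → EuclideanSpace ℂ (Fin m)) (R : ℝ) : Prop :=
  ∃ Ω ⊆ U, IsOpen Ω ∧ IsConnected Ω ∧ Set.InjOn F Ω ∧
    ∃ w : EuclideanSpace ℂ (Fin m), Metric.ball w R ⊆ F '' Ω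

/-- The explicit constant
`σ(1-σ)/((2-σ)2^m) * e^{-1/(γ-1) + (1/2)/(γ^2-1) - (1/3)/(γ^3-1)} / γ`. -/
def explicitConst (m : ℕ) (σ γ : ℝ) : ℝ :=
  σ * (1 - σ) / ((2 - σ) * 2 ^ m) *
    (Real.exp (-(1 / (γ - 1)) + 1 / 2 * (1 / (γ ^ 2 - 1)) - 1 / 3 * (1 / (γ ^ 3 - 1))) / γ)

end

end BlochWu

/-! This is Bloch's argument on the unit ball, and it gives the smaller power `K ^ (m - 1)`. The
maximum of `(r - ‖z‖) ^ m * ‖det F'(z)‖` over a closed ball of radius `r < 1` picks a centre `z₀`,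
with `ρ = r - ‖z₀‖`, near which the Jacobian is at most `2 ^ m` times its value `D` at `z₀`
(`exists_bloch_point`). Schwarz's lemma on complex lines keeps it above `D / 2` on a ball of radius
comparable to `ρ` (`half_norm_det_le`). There Hadamard's inequality and the Wu condition bound
`F'⁻¹` (`exists_inverse_norm_le`), and segments from `F z₀` lift through `F` by an ODE
(`exists_schlicht_domain`). The lifted endpoints form the schlicht domain.

The stated radii follow because `K ≥ 1`, `m - 1 ≤ 3m/2 - 1/2`, and the explicit constant is small
for all `σ`, `γ`. The polydisk contains the ball, and the factor `m ^ (-1/2)` only weakens the ball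
case. -/

namespace BlochWu

open Metric Set Filter Topology InnerProductSpace
open scoped NNReal

/-! ### Hadamard's inequality and the smallest singular value. -/

section LinearAlgebra

variable {E : Type*} [NormedAddCommGroup E] [InnerProductSpace ℂ E] [FiniteDimensional ℂ E]

/-- Hadamard's inequality for the determinant of an operator. -/
theorem norm_det_le_prod_norm_apply {m : ℕ} (A : E →L[ℂ] E) (b : OrthonormalBasis (Fin m) ℂ E) :
    ‖A.det‖ ≤ ∏ i, ‖A (b i)‖ := by
  have hfr : Module.finrank ℂ E = Fintype.card (Fin m) :=
    Module.finrank_eq_card_basis b.toBasis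
  -- From `b` to the Gram–Schmidt basis of the images `A (b i)`, the matrix of `A` is triangular,
  -- and each diagonal entry is an inner product of `A (b i)` with a unit vector.
  let g := gramSchmidtOrthonormalBasis hfr (fun i => A (b i))
  have h1 : ‖A.det‖ = ‖g.toBasis.det (fun i => A (b i))‖ := by
    have h := (A : E →ₗ[ℂ] E).normDet_eq_norm_det_toMatrix b g
    rw [LinearMap.normDet_eq_norm_det] at h
    rw [ContinuousLinearMap.det, h, Module.Basis.det_apply]
    congr 2
    ext i j
    simp [LinearMap.toMatrix_apply, Module.Basis.toMatrix_apply]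
  rw [h1, gramSchmidtOrthonormalBasis_det, norm_prod]
  refine Finset.prod_le_prod (fun _ _ => norm_nonneg _) fun i _ => ?_
  refine (norm_inner_le_norm _ _).trans ?_
  simp [(gramSchmidtOrthonormalBasis hfr (fun i => A (b i))).norm_eq_one i]

theorem norm_det_le_norm_pow (A : E →L[ℂ] E) : ‖A.det‖ ≤ ‖A‖ ^ Module.finrank ℂ E := by
  refine (norm_det_le_prod_norm_apply A (stdOrthonormalBasis ℂ E)).trans ?_
  calc ∏ i, ‖A (stdOrthonormalBasis ℂ E i)‖ ≤ ∏ _i : Fin (Module.finrank ℂ E), ‖A‖ := by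
        refine Finset.prod_le_prod (fun _ _ => norm_nonneg _) fun i _ => ?_
        simpa using A.le_opNorm (stdOrthonormalBasis ℂ E i)
    _ = _ := by simp

/-- Hadamard's inequality in an orthonormal basis extending `v / ‖v‖`: one factor is `‖A v‖ / ‖v‖`,
the others are at most `‖A‖`. This bounds the smallest singular value below. -/
theorem norm_det_mul_norm_le (A : E →L[ℂ] E) (v : E) :
    ‖A.det‖ * ‖v‖ ≤ ‖A‖ ^ (Module.finrank ℂ E - 1) * ‖A v‖ := by
  rcases eq_or_ne v 0 with rfl | hv
  · simp
  have hv' : 0 < ‖v‖ := norm_pos_iff.2 hv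
  have : Nontrivial E := ⟨v, 0, hv⟩
  have hpos : 0 < Module.finrank ℂ E := Module.finrank_pos
  set n := Module.finrank ℂ E with hn
  let i₀ : Fin n := ⟨0, hpos⟩
  let u : Fin n → E := fun _ => (‖v‖⁻¹ : ℂ) • v
  have hu : Orthonormal ℂ (({i₀} : Set (Fin n)).domRestrict u) := by
    constructor
    · intro i
      simp [u, Set.domRestrict_apply, norm_smul, hv'.ne']
    · intro i j hij
      exact absurd (Subsingleton.elim i j) hij
  obtain ⟨b, hb⟩ := hu.exists_orthonormalBasis_extension_of_card_eq (by simp [hn])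
  have hb0 : b i₀ = (‖v‖⁻¹ : ℂ) • v := hb i₀ rfl
  have h1 := norm_det_le_prod_norm_apply A b
  rw [← Finset.mul_prod_erase _ _ (Finset.mem_univ i₀), hb0] at h1
  have h2 : ∏ i ∈ Finset.univ.erase i₀, ‖A (b i)‖ ≤ ‖A‖ ^ (n - 1) := by
    calc _ ≤ ∏ _i ∈ Finset.univ.erase i₀, ‖A‖ := by
          refine Finset.prod_le_prod (fun _ _ => norm_nonneg _) fun i _ => ?_
          simpa using A.le_opNorm (b i)
      _ = _ := by simp
  have h3 : ‖A ((‖v‖⁻¹ : ℂ) • v)‖ * ‖v‖ = ‖A v‖ := by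
    rw [map_smul, norm_smul]; simp; field_simp
  calc ‖A.det‖ * ‖v‖ ≤ (‖A ((‖v‖⁻¹ : ℂ) • v)‖ * ‖A‖ ^ (n - 1)) * ‖v‖ := by
        gcongr; exact h1.trans (by gcongr)
    _ = ‖A‖ ^ (n - 1) * (‖A ((‖v‖⁻¹ : ℂ) • v)‖ * ‖v‖) := by ring
    _ = _ := by rw [h3]

end LinearAlgebra

/-! ### Regularity of the derivative and of the Jacobian determinant. -/

section Holomorphic

variable {E G : Type*} [NormedAddCommGroup E] [NormedSpace ℂ E]
  [NormedAddCommGroup G] [NormedSpace ℂ G]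

/-- A function holomorphic and bounded near `c` has a Lipschitz derivative near `c`. -/
theorem exists_lipschitz_fderiv_of_bounded {f : E → G} {c : E} {R M : ℝ} (hR : 0 < R)
    (hd : DifferentiableOn ℂ f (ball c (4 * R))) (hb : ∀ z ∈ ball c (4 * R), ‖f z‖ ≤ M) :
    ∀ x ∈ ball c R, ∀ y ∈ ball c R,
      ‖fderiv ℂ f y - fderiv ℂ f x‖ ≤ 4 * M / R / R * ‖y - x‖ := by
  have hC : ∀ z ∈ ball c (3 * R), ‖fderiv ℂ f z‖ ≤ 2 * M / R := by
    intro z hz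
    have hsub : ball z R ⊆ ball c (4 * R) := ball_subset_ball' (by
      rw [mem_ball] at hz; linarith)
    refine Complex.norm_fderiv_le_div_of_mapsTo_ball (hd.mono hsub) (fun w hw => ?_) hR
    rw [mem_closedBall, dist_eq_norm]
    have := norm_sub_le (f w) (f z)
    linarith [hb w (hsub hw), hb z (hsub (mem_ball_self hR))]
  intro x hx y hy
  rw [mem_ball, dist_eq_norm] at hx hy
  have hyx : ‖y - x‖ < 2 * R := by
    calc ‖y - x‖ = ‖(y - c) - (x - c)‖ := by congr 1; abel
      _ ≤ ‖y - c‖ + ‖x - c‖ := norm_sub_le _ _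
      _ < 2 * R := by linarith
  set h := y - x with hh
  have hmem : ∀ w ∈ ball x R, w ∈ ball c (3 * R) ∧ w + h ∈ ball c (3 * R) ∧
      w ∈ ball c (4 * R) ∧ w + h ∈ ball c (4 * R) := by
    intro w hw
    rw [mem_ball, dist_eq_norm] at hw
    have h1 : ‖w - c‖ < 2 * R := by
      calc ‖w - c‖ = ‖(w - x) + (x - c)‖ := by congr 1; abel
        _ ≤ _ := norm_add_le _ _
        _ < _ := by linarith
    have h2 : ‖w + h - c‖ < 2 * R := by
      calc ‖w + h - c‖ = ‖(w - x) + (y - c)‖ := by congr 1; rw [hh]; abel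
        _ ≤ _ := norm_add_le _ _
        _ < _ := by linarith
    simp only [mem_ball, dist_eq_norm]
    refine ⟨?_, ?_, ?_, ?_⟩ <;> linarith
  have hdiff : ∀ z ∈ ball c (4 * R), DifferentiableAt ℂ f z := fun z hz =>
    hd.differentiableAt (isOpen_ball.mem_nhds hz)
  -- The first-order Cauchy estimate for this difference replaces a bound on the second derivative:
  -- `g` is `O(‖h‖)` by the mean value inequality.
  let g : E → G := fun w => f (w + h) - f w
  have hg : DifferentiableOn ℂ g (ball x R) := by
    intro w hw
    obtain ⟨-, -, h3, h4⟩ := hmem w hw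
    exact (((hdiff _ h4).comp w (differentiableAt_id.add_const h)).sub
      (hdiff _ h3)).differentiableWithinAt
  have hgb : ∀ w ∈ ball x R, ‖g w‖ ≤ 2 * M / R * ‖h‖ := by
    intro w hw
    obtain ⟨h1, h2, -, -⟩ := hmem w hw
    have := (convex_ball c (3 * R)).norm_image_sub_le_of_norm_fderiv_le (𝕜 := ℂ) (f := f)
      (fun z hz => hdiff z (ball_subset_ball (by linarith) hz)) hC h1 h2
    simpa [g] using this
  have hx0 : x ∈ ball x R := mem_ball_self hR
  obtain ⟨-, -, h3, h4⟩ := hmem x hx0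
  have hfg : fderiv ℂ g x = fderiv ℂ f y - fderiv ℂ f x := by
    have hxy : x + h = y := by rw [hh]; abel
    have h5 : HasFDerivAt f (fderiv ℂ f y) (x + h) := by
      rw [hxy]; rw [hxy] at h4; exact (hdiff _ h4).hasFDerivAt
    exact (((hasFDerivAt_comp_add_right h).2 h5).sub (hdiff x h3).hasFDerivAt).fderiv
  rw [← hfg]
  refine (Complex.norm_fderiv_le_div_of_mapsTo_ball hg (R₂ := 2 * (2 * M / R * ‖h‖))
    (fun w hw => ?_) hR).trans_eq (by ring)
  rw [mem_closedBall, dist_eq_norm]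
  have := norm_sub_le (g w) (g x)
  linarith [hgb w hw, hgb x hx0]

theorem exists_lipschitzOnWith_fderiv_ball {f : E → G} {U : Set E} (hU : IsOpen U)
    (hd : DifferentiableOn ℂ f U) {c : E} (hc : c ∈ U) :
    ∃ R > 0, ball c R ⊆ U ∧ ∃ L : ℝ≥0, LipschitzOnWith L (fderiv ℂ f) (ball c R) := by
  have hcont : ContinuousAt f c := (hd.differentiableAt (hU.mem_nhds hc)).continuousAt
  have hev : ∀ᶠ z in 𝓝 c, z ∈ U ∧ ‖f z‖ < ‖f c‖ + 1 :=
    (hU.eventually_mem hc).and (hcont.norm.eventually (gt_mem_nhds (by linarith)))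
  obtain ⟨ε, hε, h⟩ := Metric.eventually_nhds_iff_ball.1 hev
  have hR : 0 < ε / 4 := by positivity
  have hεR : 4 * (ε / 4) = ε := by ring
  refine ⟨ε / 4, hR, fun z hz => (h z (ball_subset_ball (by linarith) hz)).1,
    (4 * (‖f c‖ + 1) / (ε / 4) / (ε / 4)).toNNReal, ?_⟩
  refine LipschitzOnWith.of_dist_le_mul fun y hy x hx => ?_
  rw [Real.coe_toNNReal _ (by positivity), dist_eq_norm, dist_eq_norm]
  refine exists_lipschitz_fderiv_of_bounded hR ?_ ?_ x hx y hy
  · rw [hεR]; exact hd.mono fun z hz => (h z hz).1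
  · rw [hεR]; exact fun z hz => (h z hz).2.le

theorem locallyLipschitzOn_fderiv {f : E → G} {U : Set E} (hU : IsOpen U)
    (hd : DifferentiableOn ℂ f U) : LocallyLipschitzOn U (fderiv ℂ f) := by
  intro c hc
  obtain ⟨R, hR, -, L, hL⟩ := exists_lipschitzOnWith_fderiv_ball hU hd hc
  exact ⟨L, ball c R, mem_nhdsWithin_of_mem_nhds (ball_mem_nhds c hR), hL⟩

/-- The derivative of a holomorphic map is holomorphic along complex lines. -/
theorem differentiableOn_fderiv_line [CompleteSpace G] {f : E → G} {U : Set E} (hU : IsOpen U)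
    (hd : DifferentiableOn ℂ f U) (z v u : E) :
    DifferentiableOn ℂ (fun ζ : ℂ => fderiv ℂ f (z + ζ • v) u) {ζ | z + ζ • v ∈ U} := by
  intro ζ₀ hζ₀
  refine DifferentiableAt.differentiableWithinAt ?_
  obtain ⟨R, hR, hRU, L, hL⟩ := exists_lipschitzOnWith_fderiv_ball hU hd hζ₀
  set c := z + ζ₀ • v with hc
  have hline : Continuous fun ζ : ℂ => z + ζ • v := by fun_prop
  let V : Set ℂ := (fun ζ : ℂ => z + ζ • v) ⁻¹' ball c (R / 2)
  have hV : IsOpen V := isOpen_ball.preimage hline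
  have hζV : ζ₀ ∈ V := mem_ball_self (by positivity)
  -- Difference quotients in direction `u` are holomorphic in `ζ`; the Lipschitz bound makes them
  -- converge uniformly on `V`, so the limit is holomorphic.
  let Φ : ℂ → ℂ → G := fun h ζ => h⁻¹ • (f (z + ζ • v + h • u) - f (z + ζ • v))
  have hsmall : ∀ᶠ h : ℂ in 𝓝[≠] 0, ‖h • u‖ < R / 2 ∧ h ≠ 0 := by
    refine Filter.Eventually.and ?_ self_mem_nhdsWithin
    refine nhdsWithin_le_nhds ?_
    have : Tendsto (fun h : ℂ => ‖h • u‖) (𝓝 0) (𝓝 0) := by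
      have h : Continuous fun h : ℂ => ‖h • u‖ := by fun_prop
      simpa using h.tendsto 0
    exact this.eventually (gt_mem_nhds (by positivity))
  have hmem : ∀ h : ℂ, ‖h • u‖ < R / 2 → ∀ ζ ∈ V,
      z + ζ • v ∈ ball c R ∧ z + ζ • v + h • u ∈ ball c R := by
    intro h hh ζ hζ
    have hζ' : ‖z + ζ • v - c‖ < R / 2 := by simpa [V, dist_eq_norm] using hζ
    simp only [mem_ball, dist_eq_norm]
    refine ⟨by linarith, ?_⟩
    calc ‖z + ζ • v + h • u - c‖ = ‖(z + ζ • v - c) + h • u‖ := by congr 1; abel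
      _ ≤ _ := norm_add_le _ _
      _ < _ := by linarith
  have hdiff : ∀ x ∈ ball c R, DifferentiableAt ℂ f x := fun x hx =>
    hd.differentiableAt (hU.mem_nhds (hRU hx))
  have hest : ∀ h : ℂ, ‖h • u‖ < R / 2 → h ≠ 0 → ∀ ζ ∈ V,
      ‖fderiv ℂ f (z + ζ • v) u - Φ h ζ‖ ≤ L * ‖u‖ * ‖h • u‖ := by
    intro h hh h0 ζ hζ
    obtain ⟨h1, h2⟩ := hmem h hh ζ hζ
    set x := z + ζ • v
    have hseg : segment ℝ x (x + h • u) ⊆ ball c R := (convex_ball c R).segment_subset h1 h2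
    have key := (convex_segment x (x + h • u)).norm_image_sub_le_of_norm_fderiv_le' (𝕜 := ℂ)
      (f := f) (φ := fderiv ℂ f x) (C := L * ‖h • u‖) (fun y hy => hdiff y (hseg hy))
      (fun y hy => by
        have h3 := hL.dist_le_mul y (hseg hy) x h1
        rw [dist_eq_norm, dist_eq_norm] at h3
        refine h3.trans ?_
        gcongr
        have := norm_sub_le_of_mem_segment hy
        simpa using this)
      (left_mem_segment ℝ _ _) (right_mem_segment ℝ _ _)
    rw [add_sub_cancel_left, map_smul] at key
    have h4 : fderiv ℂ f x u - Φ h ζ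
        = -(h⁻¹ • (f (x + h • u) - f x - h • fderiv ℂ f x u)) := by
      simp only [Φ, smul_sub, smul_smul, inv_mul_cancel₀ h0, one_smul, x]
      abel
    rw [h4, norm_neg, norm_smul, norm_inv]
    calc ‖h‖⁻¹ * ‖f (x + h • u) - f x - h • fderiv ℂ f x u‖
        ≤ ‖h‖⁻¹ * (L * ‖h • u‖ * ‖h • u‖) := by gcongr
      _ = _ := by
        have : ‖h‖ ≠ 0 := norm_ne_zero_iff.2 h0
        rw [norm_smul]; field_simp
  have hunif : TendstoUniformlyOn Φ (fun ζ => fderiv ℂ f (z + ζ • v) u) (𝓝[≠] 0) V := by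
    rw [Metric.tendstoUniformlyOn_iff]
    intro ε hε
    have hlim : Tendsto (fun h : ℂ => L * ‖u‖ * ‖h • u‖) (𝓝[≠] 0) (𝓝 0) := by
      have h : Continuous fun h : ℂ => L * ‖u‖ * ‖h • u‖ := by fun_prop
      simpa using (h.tendsto 0).mono_left nhdsWithin_le_nhds
    filter_upwards [hsmall, hlim.eventually (gt_mem_nhds hε)] with h hh hε' ζ hζ
    rw [dist_eq_norm]
    exact (hest h hh.1 hh.2 ζ hζ).trans_lt hε'
  have hΦ : ∀ᶠ h : ℂ in 𝓝[≠] 0, DifferentiableOn ℂ (Φ h) V := by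
    filter_upwards [hsmall] with h hh ζ hζ
    obtain ⟨h1, h2⟩ := hmem h hh.1 ζ hζ
    have hl : DifferentiableAt ℂ (fun ζ : ℂ => z + ζ • v) ζ := by fun_prop
    exact ((((hdiff _ h2).comp (f := fun ζ : ℂ => z + ζ • v + h • u) ζ (hl.add_const _)).sub
      ((hdiff _ h1).comp (f := fun ζ : ℂ => z + ζ • v) ζ hl)).const_smul
      h⁻¹).differentiableWithinAt
  exact (hunif.tendstoLocallyUniformlyOn.differentiableOn hΦ hV).differentiableAt
    (hV.mem_nhds hζV)

/-- The Jacobian determinant of a holomorphic map is holomorphic along complex lines. -/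
theorem differentiableOn_det_fderiv_line [FiniteDimensional ℂ E] {f : E → E} {U : Set E}
    (hU : IsOpen U) (hd : DifferentiableOn ℂ f U) (z v : E) :
    DifferentiableOn ℂ (fun ζ : ℂ => (fderiv ℂ f (z + ζ • v)).det) {ζ | z + ζ • v ∈ U} := by
  have := FiniteDimensional.complete ℂ E
  let b := Module.finBasis ℂ E
  have h1 : ∀ A : E →L[ℂ] E, A.det = ∑ σ : Equiv.Perm (Fin (Module.finrank ℂ E)),
      (Equiv.Perm.sign σ : ℂ) * ∏ i, b.coord (σ i) (A (b i)) := by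
    intro A
    rw [ContinuousLinearMap.det, ← LinearMap.det_toMatrix b, Matrix.det_apply']
    simp [LinearMap.toMatrix_apply]
  simp_rw [h1]
  refine DifferentiableOn.fun_sum fun σ _ => DifferentiableOn.const_mul ?_ _
  refine DifferentiableOn.fun_finsetProd fun i _ => ?_
  exact (LinearMap.toContinuousLinearMap (b.coord (σ i))).differentiable.comp_differentiableOn
    (differentiableOn_fderiv_line hU hd z v (b i))

end Holomorphic

/-! ### Lifting segments through a local diffeomorphism. -/

section Lifting

variable {E G : Type*} [NormedAddCommGroup E] [NormedSpace ℝ E] [CompleteSpace E]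
  [NormedAddCommGroup G] [NormedSpace ℝ G]

/-- The Picard–Lindelöf theorem for an autonomous field on a closed ball, on the time interval
`[0, 1]`, with the information that the solution does not leave the ball. -/
theorem exists_integral_curve_closedBall {v : E → E} {x₀ : E} {a L K : ℝ≥0}
    (hb : ∀ x ∈ closedBall x₀ a, ‖v x‖ ≤ L) (hl : LipschitzOnWith K v (closedBall x₀ a))
    (hLa : L ≤ a) :
    ∃ α : ℝ → E, α 0 = x₀ ∧ (∀ t, α t ∈ closedBall x₀ a) ∧
      ∀ t ∈ Icc (0 : ℝ) 1, HasDerivWithinAt α (v (α t)) (Icc 0 1) t := by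
  let t₀ : Icc (0 : ℝ) 1 := ⟨0, by simp⟩
  have hf : IsPicardLindelof (fun _ => v) t₀ x₀ a 0 L K :=
    .of_time_independent hb hl (by simpa [t₀] using hLa)
  have hx : x₀ ∈ closedBall x₀ ((0 : ℝ≥0) : ℝ) := by simp
  obtain ⟨α, hα⟩ := ODE.FunSpace.exists_isFixedPt_next hf hx
  refine ⟨α.compProj, ?_, fun t => α.compProj_mem_closedBall hf.mul_max_le, fun t ht => ?_⟩
  · have : α.compProj (t₀ : ℝ) = x₀ := by
      rw [ODE.FunSpace.compProj_val, ← hα, ODE.FunSpace.next_apply₀]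
    exact this
  · apply ODE.hasDerivWithinAt_picard_Icc t₀.2 hf.continuousOn_uncurry
      α.continuous_compProj.continuousOn
      (fun _ _ => α.compProj_mem_closedBall hf.mul_max_le) x₀ ht |>.congr_of_mem _ ht
    intro t' ht'
    nth_rw 1 [← hα]
    rw [ODE.FunSpace.compProj_of_mem ht', ODE.FunSpace.next_apply]

/-- If `F'` is invertible on a closed ball of radius `a`, with inverse bounded by `L`, then `F` maps
some domain in the ball bijectively onto the ball of radius `a / L` about the image of the
centre. -/
theorem exists_schlicht_domain {F : E → G} {F' : E → E →L[ℝ] G} {J : E → G →L[ℝ] E} {z₀ : E}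
    {a L : ℝ} (ha : 0 < a) (hL : 0 < L)
    (hF : ∀ z ∈ closedBall z₀ a, HasStrictFDerivAt F (F' z) z)
    (hlip : ∃ k : ℝ≥0, LipschitzOnWith k F' (closedBall z₀ a))
    (hJL : ∀ z ∈ closedBall z₀ a, ‖J z‖ ≤ L)
    (hFJ : ∀ z ∈ closedBall z₀ a, ∀ w, F' z (J z w) = w)
    (hJF : ∀ z ∈ closedBall z₀ a, ∀ w, J z (F' z w) = w) :
    ∃ Ω ⊆ closedBall z₀ a, IsOpen Ω ∧ IsConnected Ω ∧ InjOn F Ω ∧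
      ball (F z₀) (a / L) ⊆ F '' Ω := by
  obtain ⟨k, hk⟩ := hlip
  lift a to ℝ≥0 using ha.le
  have hJlip : ∀ x ∈ closedBall z₀ (a : ℝ), ∀ y ∈ closedBall z₀ (a : ℝ), ∀ w,
      ‖J x w - J y w‖ ≤ L * k * L * ‖w‖ * ‖x - y‖ := by
    intro x hx y hy w
    -- Resolvent identity: the Lipschitz bound passes from `F'` to its inverse.
    have h1 : J x w - J y w = J x ((F' y - F' x) (J y w)) := by
      simp [hFJ y hy, hJF x hx]
    have h2 := hk.dist_le_mul y hy x hx
    rw [dist_eq_norm, dist_comm, dist_eq_norm] at h2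
    calc ‖J x w - J y w‖ = ‖J x ((F' y - F' x) (J y w))‖ := by rw [h1]
      _ ≤ ‖J x‖ * (‖F' y - F' x‖ * (‖J y‖ * ‖w‖)) := by
        refine (J x).le_opNorm_of_le (((F' y - F' x).le_opNorm_of_le ((J y).le_opNorm w)))
      _ ≤ L * ((k * ‖x - y‖) * (L * ‖w‖)) := by
        gcongr
        · exact hJL x hx
        · exact hJL y hy
      _ = _ := by ring
  set w₀ := F z₀ with hw₀
  have hsol : ∀ w ∈ ball w₀ (a / L), ∃ α : ℝ → E, α 0 = z₀ ∧
      (∀ t, α t ∈ closedBall z₀ (a : ℝ)) ∧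
      ∀ t ∈ Icc (0 : ℝ) 1, HasDerivWithinAt α (J (α t) (w - w₀)) (Icc 0 1) t := by
    intro w hw
    rw [mem_ball, dist_eq_norm, lt_div_iff₀ hL] at hw
    refine exists_integral_curve_closedBall (v := fun z => J z (w - w₀))
      (L := (L * ‖w - w₀‖).toNNReal) (K := (L * k * L * ‖w - w₀‖).toNNReal) ?_ ?_ ?_
    · intro x hx
      rw [Real.coe_toNNReal _ (by positivity)]
      exact (J x).le_of_opNorm_le (hJL x hx) _
    · refine LipschitzOnWith.of_dist_le_mul fun x hx y hy => ?_
      rw [Real.coe_toNNReal _ (by positivity), dist_eq_norm, dist_eq_norm]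
      exact hJlip x hx y hy _
    -- The speed is at most `L * ‖w - w₀‖ < a`, so the curve stays in the ball up to time 1.
    · rw [Real.toNNReal_le_iff_le_coe]; linarith
  choose! α hα0 hαmem hα using hsol
  have hcont : ∀ w ∈ ball w₀ (a / L), ContinuousOn (α w) (Icc 0 1) := fun w hw t ht =>
    (hα w hw t ht).continuousWithinAt
  have hright : ∀ w ∈ ball w₀ (a / L), ∀ t ∈ Ico (0 : ℝ) 1,
      HasDerivWithinAt (α w) (J (α w t) (w - w₀)) (Ici t) t := fun w hw t ht =>
    (hα w hw t ⟨ht.1, ht.2.le⟩).mono_of_mem_nhdsWithin (Icc_mem_nhdsGE_of_mem ht)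
  let g : G → E := fun w => α w 1
  have hFg : ∀ w ∈ ball w₀ (a / L), F (g w) = w := by
    intro w hw
    -- Along the flow of `J z (w - w₀)` the image moves with constant velocity `w - w₀`, so it
    -- reaches `w` at time 1.
    have hder : ∀ t ∈ Ico (0 : ℝ) 1,
        HasDerivWithinAt (fun t => F (α w t) - t • (w - w₀)) 0 (Ici t) t := by
      intro t ht
      have h1 := (hF (α w t) (hαmem w hw t)).hasFDerivAt.comp_hasDerivWithinAt t
        (hright w hw t ht)
      rw [hFJ _ (hαmem w hw t)] at h1
      have h2 : HasDerivWithinAt (fun t : ℝ => t • (w - w₀)) (w - w₀) (Ici t) t := by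
        simpa using ((hasDerivAt_id t).smul_const (w - w₀)).hasDerivWithinAt
      have h3 := h1.sub h2
      rw [sub_self] at h3
      exact h3
    have hcF : ContinuousOn (fun t => F (α w t) - t • (w - w₀)) (Icc 0 1) := by
      intro t ht
      have h1 : ContinuousAt F (α w t) := (hF (α w t) (hαmem w hw t)).hasFDerivAt.continuousAt
      exact (h1.comp_continuousWithinAt (hcont w hw t ht)).sub
        (continuous_id.smul continuous_const).continuousWithinAt
    have := constant_of_has_deriv_right_zero hcF hder 1 (by simp)
    simp only [one_smul, zero_smul, sub_zero, hα0 w hw] at this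
    rw [← hw₀] at this
    have h3 : F (α w 1) = w₀ + (w - w₀) := sub_eq_iff_eq_add.1 this
    simpa using h3
  have hgcont : ContinuousOn g (ball w₀ (a / L)) := by
    intro w hw
    set K : ℝ≥0 := (L * k * L * ‖w - w₀‖).toNNReal
    -- Grönwall: the curve for `w'` solves the equation for `w` with error at most `L * ‖w' - w‖`.
    have hbound : ∀ w' ∈ ball w₀ (a / L),
        dist (g w') (g w) ≤ gronwallBound 0 K (L * ‖w' - w‖) 1 := by
      intro w' hw'
      have h := dist_le_of_approx_trajectories_ODE_of_mem (v := fun _ z => J z (w - w₀)) (K := K)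
        (s := fun _ => closedBall z₀ (a : ℝ)) (f := α w') (g := α w)
        (f' := fun t => J (α w' t) (w' - w₀)) (g' := fun t => J (α w t) (w - w₀))
        (a := 0) (b := 1) (δ := 0) (εf := L * ‖w' - w‖) (εg := 0)
        (fun t _ => LipschitzOnWith.of_dist_le_mul fun x hx y hy => by
          rw [Real.coe_toNNReal _ (by positivity), dist_eq_norm, dist_eq_norm]
          exact hJlip x hx y hy _)
        (hcont w' hw') (hright w' hw')
        (fun t _ => by
          rw [dist_eq_norm, ← map_sub, sub_sub_sub_cancel_right]
          exact (J _).le_of_opNorm_le (hJL _ (hαmem w' hw' t)) _)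
        (fun t _ => hαmem w' hw' t)
        (hcont w hw) (hright w hw) (fun t _ => by simp) (fun t _ => hαmem w hw t)
        (by simp [hα0 w hw, hα0 w' hw']) 1 (by simp)
      simpa using h
    have hlim : Tendsto (fun w' => gronwallBound 0 K (L * ‖w' - w‖) 1)
        (𝓝[ball w₀ (a / L)] w) (𝓝 0) := by
      have hc : Continuous fun w' => gronwallBound 0 K (L * ‖w' - w‖) 1 :=
        (gronwallBound_continuous_ε 0 K 1).comp (by fun_prop)
      simpa [gronwallBound_ε0_δ0] using (hc.tendsto w).mono_left nhdsWithin_le_nhds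
    refine tendsto_iff_dist_tendsto_zero.2 (squeeze_zero' (Eventually.of_forall fun _ =>
      dist_nonneg) ?_ hlim)
    filter_upwards [self_mem_nhdsWithin] with w' hw' using hbound w' hw'
  have hmemg : ∀ w ∈ ball w₀ (a / L), g w ∈ closedBall z₀ (a : ℝ) := fun w hw => hαmem w hw 1
  refine ⟨g '' ball w₀ (a / L), ?_, ?_, ?_, ?_, fun w hw => ⟨g w, ⟨w, hw, rfl⟩, hFg w hw⟩⟩
  · rintro _ ⟨w, hw, rfl⟩
    exact hmemg w hw
  -- Openness: `z` and `g (F z)` have the same image and, for `z` near `g w`, both lie where `F` is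
  -- injective, so `z = g (F z)`.
  · rw [isOpen_iff_mem_nhds]
    rintro _ ⟨w, hw, rfl⟩
    have hst := hF (g w) (hmemg w hw)
    let e : E ≃L[ℝ] G := ContinuousLinearEquiv.equivOfInverse (F' (g w)) (J (g w))
      (hJF _ (hmemg w hw)) (hFJ _ (hmemg w hw))
    have hste : HasStrictFDerivAt F (e : E →L[ℝ] G) (g w) := hst
    obtain ⟨V, hV, hinj⟩ : ∃ V ∈ 𝓝 (g w), InjOn F V :=
      ⟨_, (hste.toOpenPartialHomeomorph F).open_source.mem_nhds
        hste.mem_toOpenPartialHomeomorph_source,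
        (hste.toOpenPartialHomeomorph F).injOn⟩
    have hFc : Tendsto F (𝓝 (g w)) (𝓝 w) := by
      have := hst.hasFDerivAt.continuousAt.tendsto
      rwa [hFg w hw] at this
    have hgc : Tendsto g (𝓝 w) (𝓝 (g w)) :=
      (hgcont.continuousAt (isOpen_ball.mem_nhds hw)).tendsto
    filter_upwards [hV, (hgc.comp hFc).eventually hV,
      hFc.eventually (isOpen_ball.mem_nhds hw)] with z hz hz' hz''
    exact ⟨F z, hz'', hinj hz' hz (hFg _ hz'')⟩
  · exact ((convex_ball w₀ (a / L)).isConnected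
      ⟨w₀, mem_ball_self (div_pos ha hL)⟩).image g hgcont
  · rintro _ ⟨w, hw, rfl⟩ _ ⟨w', hw', rfl⟩ h
    rw [hFg w hw, hFg w' hw'] at h
    rw [h]

end Lifting

/-! ### Bloch's theorem on the ball under the Wu condition. -/

section Bloch

variable {E : Type*} [NormedAddCommGroup E] [InnerProductSpace ℂ E] [FiniteDimensional ℂ E]

/-- A bounded inverse of an operator that satisfies the Wu condition. -/
theorem exists_inverse_norm_le {m : ℕ} (hm : 1 ≤ m) (hE : Module.finrank ℂ E = m) {K δ : ℝ}
    (hK : 0 < K) (hδ : 0 < δ) {A : E →L[ℂ] E} (hA : ‖A‖ ≤ K * ‖A.det‖ ^ (1 / (m : ℝ)))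
    (hdet : δ ^ m ≤ ‖A.det‖) :
    ∃ B : E →L[ℂ] E, ‖B‖ ≤ K ^ (m - 1) / δ ∧ (∀ w, A (B w) = w) ∧ ∀ w, B (A w) = w := by
  set q := ‖A.det‖ ^ (1 / (m : ℝ)) with hq
  have hm0 : m ≠ 0 := by omega
  have hq0 : 0 ≤ q := by positivity
  have hqm : q ^ m = ‖A.det‖ := by
    rw [hq, one_div, Real.rpow_inv_natCast_pow (norm_nonneg _) hm0]
  have hδq : δ ≤ q := by
    rw [← hqm] at hdet
    exact (pow_le_pow_iff_left₀ hδ.le hq0 hm0).1 hdet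
  have hqpos : 0 < q := hδ.trans_le hδq
  have hne : A.det ≠ 0 := by
    rw [← norm_pos_iff, ← hqm]; positivity
  let e := A.toContinuousLinearEquivOfDetNeZero hne
  have he : ∀ w, e w = A w := fun w => A.toContinuousLinearEquivOfDetNeZero_apply hne w
  have hlow : ∀ v, δ * ‖v‖ ≤ K ^ (m - 1) * ‖A v‖ := by
    intro v
    have h1 := norm_det_mul_norm_le A v
    rw [hE, ← hqm] at h1
    -- With `‖A‖ ≤ K * q` and `‖det A‖ = q ^ m`, the factor `q ^ (m - 1)` cancels.
    have h2 : q ^ (m - 1) * (q * ‖v‖) ≤ q ^ (m - 1) * (K ^ (m - 1) * ‖A v‖) := by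
      calc q ^ (m - 1) * (q * ‖v‖) = q ^ m * ‖v‖ := by
            rw [← mul_assoc, ← pow_succ, Nat.sub_add_cancel hm]
        _ ≤ ‖A‖ ^ (m - 1) * ‖A v‖ := h1
        _ ≤ (K * q) ^ (m - 1) * ‖A v‖ := by gcongr
        _ = _ := by rw [mul_pow]; ring
    have h3 := le_of_mul_le_mul_left h2 (by positivity)
    exact (mul_le_mul_of_nonneg_right hδq (norm_nonneg v)).trans h3
  refine ⟨(e.symm : E →L[ℂ] E), ?_, fun w => ?_, fun w => ?_⟩
  · refine ContinuousLinearMap.opNorm_le_bound _ (by positivity) fun w => ?_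
    have h := hlow (e.symm w)
    rw [← he, e.apply_symm_apply] at h
    rw [div_mul_eq_mul_div, le_div_iff₀ hδ, mul_comm]
    exact h
  · rw [← he]; exact e.apply_symm_apply w
  · rw [← he]; exact e.symm_apply_apply w

/-- A point where the Jacobian, weighted by a power of the distance to the boundary, is maximal. -/
theorem exists_bloch_point {m : ℕ} (hm : 1 ≤ m) {F : E → E} (hF : DifferentiableOn ℂ F (ball 0 1))
    (hF0 : ‖(fderiv ℂ F 0).det‖ = 1) {r : ℝ} (hr0 : 0 < r) (hr1 : r < 1) :
    ∃ (z₀ : E) (ρ : ℝ), 0 < ρ ∧ ball z₀ ρ ⊆ ball 0 1 ∧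
      r ^ m ≤ ρ ^ m * ‖(fderiv ℂ F z₀).det‖ ∧
      ∀ z ∈ ball z₀ (ρ / 2), ‖(fderiv ℂ F z).det‖ ≤ 2 ^ m * ‖(fderiv ℂ F z₀).det‖ := by
  have hm0 : m ≠ 0 := by omega
  have hsub : closedBall (0 : E) r ⊆ ball 0 1 := closedBall_subset_ball hr1
  have hcont : ContinuousOn (fun z => ‖(fderiv ℂ F z).det‖) (closedBall 0 r) :=
    (ContinuousLinearMap.continuous_det.comp_continuousOn
      ((locallyLipschitzOn_fderiv isOpen_ball hF).continuousOn.mono hsub)).norm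
  have := FiniteDimensional.proper ℂ E
  obtain ⟨z₀, hz₀, hmax⟩ := (isCompact_closedBall (0 : E) r).exists_isMaxOn
    ⟨0, mem_closedBall_self hr0.le⟩
    (f := fun z => (r - ‖z‖) ^ m * ‖(fderiv ℂ F z).det‖)
    (((continuous_const.sub continuous_norm).pow m).continuousOn.mul hcont)
  have h0 : r ^ m ≤ (r - ‖z₀‖) ^ m * ‖(fderiv ℂ F z₀).det‖ := by
    have := hmax (mem_closedBall_self hr0.le)
    simpa [hF0] using this
  have hz₀r : ‖z₀‖ ≤ r := by simpa using hz₀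
  -- The weight vanishes on the sphere of radius `r`, whereas the maximum is at least `r ^ m > 0`.
  have hρ : 0 < r - ‖z₀‖ := by
    refine lt_of_le_of_ne (by linarith) fun h => ?_
    rw [← h, zero_pow hm0, zero_mul] at h0
    exact absurd h0 (not_le.2 (by positivity))
  refine ⟨z₀, r - ‖z₀‖, hρ, ball_subset_ball' (by simp; linarith), h0, fun z hz => ?_⟩
  rw [mem_ball, dist_eq_norm] at hz
  have hz1 : ‖z‖ ≤ ‖z - z₀‖ + ‖z₀‖ := by simpa using norm_add_le (z - z₀) z₀
  have h1 : (r - ‖z‖) ^ m * ‖(fderiv ℂ F z).det‖ ≤ (r - ‖z₀‖) ^ m * ‖(fderiv ℂ F z₀).det‖ :=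
    hmax (by rw [mem_closedBall, dist_zero_right]; linarith : z ∈ closedBall (0 : E) r)
  have h2 : ((r - ‖z₀‖) / 2) ^ m ≤ (r - ‖z‖) ^ m := by
    gcongr; linarith
  have h3 : ((r - ‖z₀‖) / 2) ^ m * ‖(fderiv ℂ F z).det‖ ≤
      ((r - ‖z₀‖) / 2) ^ m * (2 ^ m * ‖(fderiv ℂ F z₀).det‖) := by
    calc _ ≤ (r - ‖z‖) ^ m * ‖(fderiv ℂ F z).det‖ := by gcongr
      _ ≤ _ := h1
      _ = _ := by rw [← mul_assoc, ← mul_pow, div_mul_cancel₀ _ two_ne_zero]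
  exact le_of_mul_le_mul_left h3 (by positivity)

/-- If the Jacobian is at most `M` times its value at the centre of a ball of radius `s`, then it is
at least half that value on the ball of radius `s / (2 * (M + 1))`. -/
theorem half_norm_det_le {F : E → E} {z₀ : E} {s M : ℝ} (hs : 0 < s) (hM : 0 ≤ M)
    (hF : DifferentiableOn ℂ F (ball z₀ s))
    (hb : ∀ z ∈ ball z₀ s, ‖(fderiv ℂ F z).det‖ ≤ M * ‖(fderiv ℂ F z₀).det‖) :
    ∀ z ∈ closedBall z₀ (s / (2 * (M + 1))),
      ‖(fderiv ℂ F z₀).det‖ / 2 ≤ ‖(fderiv ℂ F z).det‖ := by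
  intro z hz
  set D := ‖(fderiv ℂ F z₀).det‖ with hD
  have hD0 : 0 ≤ D := norm_nonneg _
  rcases eq_or_ne z z₀ with rfl | hne
  · linarith
  set v := z - z₀ with hv
  have hv0 : 0 < ‖v‖ := norm_pos_iff.2 (sub_ne_zero.2 hne)
  rw [mem_closedBall, dist_eq_norm, ← hv, le_div_iff₀ (by positivity)] at hz
  have hvs : ‖v‖ < s := by nlinarith
  have hmem : ∀ ζ ∈ ball (0 : ℂ) (s / ‖v‖), z₀ + ζ • v ∈ ball z₀ s := by
    intro ζ hζ
    rw [mem_ball, dist_zero_right, lt_div_iff₀ hv0] at hζ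
    simpa [dist_eq_norm, norm_smul] using hζ
  have hd := (differentiableOn_det_fderiv_line isOpen_ball hF z₀ v).mono hmem
  have h1 : (1 : ℂ) ∈ ball (0 : ℂ) (s / ‖v‖) := by
    rw [mem_ball, dist_zero_right, norm_one, one_lt_div hv0]; exact hvs
  -- Schwarz's lemma at `ζ = 1` on the disc of radius `s / ‖v‖`; the values stay within `M * D + D`
  -- of the central one.
  have key := Complex.dist_le_div_mul_dist_of_mapsTo_ball hd (R₂ := (M + 1) * D)
    (fun ζ hζ => by
      rw [mem_closedBall, dist_eq_norm]
      refine (norm_sub_le _ _).trans ?_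
      have h2 := hb _ (hmem ζ hζ)
      have h3 : ‖(fderiv ℂ F (z₀ + (0 : ℂ) • v)).det‖ = D := by simp [hD]
      rw [h3]; linarith) h1
  have hz1 : z₀ + (1 : ℂ) • v = z := by simp [hv]
  rw [hz1, zero_smul, add_zero, dist_zero_right, norm_one, mul_one, dist_comm,
    dist_eq_norm] at key
  have h4 : (M + 1) * D / (s / ‖v‖) ≤ D / 2 := by
    rw [div_div_eq_mul_div, div_le_div_iff₀ hs two_pos]
    nlinarith
  have h5 := norm_sub_norm_le (fderiv ℂ F z₀).det (fderiv ℂ F z).det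
  linarith

/-- Bloch's theorem for maps of the unit ball that satisfy the Wu condition. -/
theorem exists_schlicht_domain_of_wu {m : ℕ} (hm : 1 ≤ m) (hE : Module.finrank ℂ E = m) {K : ℝ}
    (hK : 0 < K) {F : E → E} (hF : DifferentiableOn ℂ F (ball 0 1))
    (hwu : ∀ z ∈ ball (0 : E) 1, ‖fderiv ℂ F z‖ ≤ K * ‖(fderiv ℂ F z).det‖ ^ (1 / (m : ℝ)))
    (hF0 : ‖(fderiv ℂ F 0).det‖ = 1) {r : ℝ} (hr0 : 0 < r) (hr1 : r < 1) :
    ∃ Ω ⊆ ball (0 : E) 1, IsOpen Ω ∧ IsConnected Ω ∧ InjOn F Ω ∧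
      ∃ w, ball w (r / (8 * (2 ^ m + 1) * K ^ (m - 1))) ⊆ F '' Ω := by
  have hm0 : m ≠ 0 := by omega
  obtain ⟨z₀, ρ, hρ, hsub, hlow, hup⟩ := exists_bloch_point hm hF hF0 hr0 hr1
  set D := ‖(fderiv ℂ F z₀).det‖ with hD
  have hDpos : 0 < D := by
    have : 0 < ρ ^ m * D := (pow_pos hr0 m).trans_le hlow
    exact pos_of_mul_pos_right this (by positivity)
  set δ := D ^ (1 / (m : ℝ)) with hδ
  have hδpos : 0 < δ := by positivity
  have hδm : δ ^ m = D := by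
    rw [hδ, one_div, Real.rpow_inv_natCast_pow hDpos.le hm0]
  have hrδ : r ≤ ρ * δ := by
    rw [← hδm, ← mul_pow] at hlow
    exact (pow_le_pow_iff_left₀ hr0.le (by positivity) hm0).1 hlow
  set a := ρ / 2 / (2 * (2 ^ m + 1)) with ha
  have hapos : 0 < a := by positivity
  have haρ : a < ρ := by
    rw [ha, div_lt_iff₀ (by positivity)]
    have : (0 : ℝ) < 2 ^ m := by positivity
    nlinarith
  have haU : closedBall z₀ a ⊆ ball 0 1 := (closedBall_subset_ball haρ).trans hsub
  have hhalf := half_norm_det_le (F := F) (z₀ := z₀) (s := ρ / 2) (M := 2 ^ m) (by positivity)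
    (by positivity) (hF.mono ((ball_subset_ball (by linarith)).trans hsub)) hup
  have hinv : ∀ z ∈ closedBall z₀ a, ∃ B : E →L[ℂ] E, ‖B‖ ≤ K ^ (m - 1) / (δ / 2) ∧
      (∀ w, fderiv ℂ F z (B w) = w) ∧ ∀ w, B (fderiv ℂ F z w) = w := by
    intro z hz
    refine exists_inverse_norm_le hm hE hK (by positivity) (hwu z (haU hz)) ?_
    refine le_trans ?_ (hhalf z hz)
    -- `(δ / 2) ^ m = D / 2 ^ m ≤ D / 2`, since `m ≥ 1`.
    rw [div_pow, hδm]
    gcongr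
    exact le_self_pow₀ one_le_two hm0
  choose! B hB hAB hBA using hinv
  have := FiniteDimensional.complete ℂ E
  have := FiniteDimensional.proper ℂ E
  have hlip := locallyLipschitzOn_fderiv isOpen_ball hF
  obtain ⟨Ω, hΩ, hopen, hconn, hinj, hball⟩ := exists_schlicht_domain (F := F)
    (F' := fun z => (fderiv ℂ F z).restrictScalars ℝ) (J := fun z => (B z).restrictScalars ℝ)
    (z₀ := z₀) (a := a) (L := K ^ (m - 1) / (δ / 2)) hapos (by positivity)
    (fun z hz => by
      have hzU := isOpen_ball.mem_nhds (haU hz)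
      refine (hasStrictFDerivAt_of_hasFDerivAt_of_continuousAt ?_
        (hlip.continuousOn.continuousAt hzU)).restrictScalars ℝ
      filter_upwards [hzU] with y hy
      exact (hF.differentiableAt (isOpen_ball.mem_nhds hy)).hasFDerivAt)
    (by
      obtain ⟨k, hk⟩ := (hlip.mono haU).exists_lipschitzOnWith_of_compact
        (isCompact_closedBall z₀ a)
      refine ⟨k, LipschitzOnWith.of_dist_le_mul fun x hx y hy => ?_⟩
      have := hk.dist_le_mul x hx y hy
      rw [dist_eq_norm] at this ⊢
      rw [← ContinuousLinearMap.restrictScalars_sub, ContinuousLinearMap.norm_restrictScalars]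
      exact this)
    (fun z hz => by rw [ContinuousLinearMap.norm_restrictScalars]; exact hB z hz)
    (fun z hz w => hAB z hz w) (fun z hz w => hBA z hz w)
  refine ⟨Ω, hΩ.trans haU, hopen, hconn, hinj, F z₀, (ball_subset_ball ?_).trans hball⟩
  have h1 : a / (K ^ (m - 1) / (δ / 2)) = ρ * δ / (8 * (2 ^ m + 1) * K ^ (m - 1)) := by
    rw [ha]; field_simp; norm_num
  rw [h1]
  gcongr

end Bloch

/-! ### Comparison of constants and exponents. -/

section Constants

theorem CoversSchlichtBall.mono {m : ℕ} {U V : Set (EuclideanSpace ℂ (Fin m))}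
    {F : EuclideanSpace ℂ (Fin m) → EuclideanSpace ℂ (Fin m)} {R S : ℝ}
    (h : CoversSchlichtBall U F R) (hUV : U ⊆ V) (hSR : S ≤ R) : CoversSchlichtBall V F S := by
  obtain ⟨Ω, hΩ, ho, hc, hi, w, hw⟩ := h
  exact ⟨Ω, hΩ.trans hUV, ho, hc, hi, w, (ball_subset_ball hSR).trans hw⟩

theorem explicitConst_pos (m : ℕ) {σ γ : ℝ} (hσ0 : 0 < σ) (hσ1 : σ < 1) (hγ : 1 < γ) :
    0 < explicitConst m σ γ := by
  have h1 : 0 < 1 - σ := by linarith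
  have h2 : 0 < 2 - σ := by linarith
  have h3 : 0 < γ := by linarith
  unfold explicitConst
  positivity

/-- The factor in `σ` is at most `1/5` (after removing `2 ^ m`) and the factor in `γ` at most
`3/10`. -/
theorem explicitConst_le (m : ℕ) {σ γ : ℝ} (hσ0 : 0 < σ) (hσ1 : σ < 1) (hγ : 1 < γ) :
    explicitConst m σ γ ≤ 3 / 50 / 2 ^ m := by
  have h0 : 0 < γ := by linarith
  have h1 : 0 < γ - 1 := by linarith
  have h2 : 0 < γ ^ 2 - 1 := by nlinarith
  have h3 : 0 < γ ^ 3 - 1 := by nlinarith [mul_pos h0 h2]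
  -- The first two terms of the exponent add up to `-y`; the third is negative and is dropped.
  set y := (γ + 1 / 2) / (γ ^ 2 - 1) with hy
  have hy0 : 0 < y := by positivity
  have hexp : Real.exp (-(1 / (γ - 1)) + 1 / 2 * (1 / (γ ^ 2 - 1)) - 1 / 3 * (1 / (γ ^ 3 - 1)))
      ≤ 1 / (1 + y) := by
    have h4 : -(1 / (γ - 1)) + 1 / 2 * (1 / (γ ^ 2 - 1)) = -y := by
      have : γ ^ 2 - 1 = (γ - 1) * (γ + 1) := by ring
      rw [hy, this]
      have : γ + 1 ≠ 0 := by positivity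
      field_simp
      ring
    have h5 : 0 ≤ 1 / 3 * (1 / (γ ^ 3 - 1)) := by positivity
    rw [h4]
    calc Real.exp (-y - 1 / 3 * (1 / (γ ^ 3 - 1))) ≤ Real.exp (-y) :=
          Real.exp_le_exp.2 (by linarith)
      _ = 1 / Real.exp y := by rw [Real.exp_neg, one_div]
      _ ≤ 1 / (1 + y) := by
        have := Real.add_one_le_exp y
        gcongr
        linarith
  have hγ' : Real.exp (-(1 / (γ - 1)) + 1 / 2 * (1 / (γ ^ 2 - 1)) - 1 / 3 * (1 / (γ ^ 3 - 1))) / γ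
      ≤ 3 / 10 := by
    rw [div_le_iff₀ h0]
    refine hexp.trans ?_
    rw [div_le_iff₀ (by positivity), hy]
    have h6 : 3 / 10 * γ * (1 + (γ + 1 / 2) / (γ ^ 2 - 1))
        = 3 / 10 * γ * (γ ^ 2 + γ - 1 / 2) / (γ ^ 2 - 1) := by
      field_simp; ring
    rw [h6, le_div_iff₀ h2]
    -- The cubic to be shown nonnegative is `(0.3 γ + 0.38) (γ - 9/5)²` plus a linear term positive
    -- for `γ > 1`.
    nlinarith [mul_nonneg h0.le (sq_nonneg (γ - 9 / 5)), sq_nonneg (γ - 9 / 5)]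
  have hσ' : σ * (1 - σ) / ((2 - σ) * 2 ^ m) ≤ 1 / 5 / 2 ^ m := by
    rw [← div_div]
    refine div_le_div_of_nonneg_right ?_ (by positivity)
    rw [div_le_div_iff₀ (by linarith) (by norm_num)]
    nlinarith [sq_nonneg (5 * σ - 3)]
  unfold explicitConst
  calc _ ≤ 1 / 5 / 2 ^ m * (3 / 10 : ℝ) := by gcongr
    _ = _ := by ring

theorem IsNormalisedWuMapping.mono {m : ℕ} {K : ℝ} {U V : Set (EuclideanSpace ℂ (Fin m))}
    {F : EuclideanSpace ℂ (Fin m) → EuclideanSpace ℂ (Fin m)}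
    (h : IsNormalisedWuMapping K V F) (hUV : U ⊆ V) : IsNormalisedWuMapping K U F :=
  ⟨⟨h.1.1.mono hUV, fun z hz => h.1.2 z (hUV hz)⟩, h.2⟩

theorem ball_subset_polydisk (m : ℕ) :
    ball (0 : EuclideanSpace ℂ (Fin m)) 1 ⊆ polydisk 0 1 := by
  intro z hz j
  rw [mem_ball, dist_zero_right] at hz
  simpa using (PiLp.norm_apply_le z j).trans_lt hz

/-- At the origin `1 = ‖det F'(0)‖ ≤ ‖F'(0)‖ ^ m`, while the Wu condition gives `‖F'(0)‖ ≤ K`. This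
allows the exponent of `K` to be raised. -/
theorem one_le_of_isNormalisedWuMapping {m : ℕ} (hm : 1 ≤ m) {K : ℝ}
    {U : Set (EuclideanSpace ℂ (Fin m))}
    {F : EuclideanSpace ℂ (Fin m) → EuclideanSpace ℂ (Fin m)} (h0 : 0 ∈ U)
    (h : IsNormalisedWuMapping K U F) : 1 ≤ K := by
  have h1 := h.1.2 0 h0
  rw [h.2, Real.one_rpow, mul_one] at h1
  have h2 := norm_det_le_norm_pow (fderiv ℂ F 0)
  rw [h.2, finrank_euclideanSpace_fin] at h2
  have hm0 : m ≠ 0 := by omega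
  exact ((one_le_pow_iff_of_nonneg (norm_nonneg _) hm0).1 h2).trans h1

theorem IsNormalisedWuMapping.coversSchlichtBall {m : ℕ} (hm : 1 ≤ m) {K : ℝ}
    {F : EuclideanSpace ℂ (Fin m) → EuclideanSpace ℂ (Fin m)}
    (h : IsNormalisedWuMapping K (ball 0 1) F) {σ γ : ℝ} (hσ0 : 0 < σ) (hσ1 : σ < 1)
    (hγ : 1 < γ) :
    CoversSchlichtBall (ball 0 1) F
      (explicitConst m σ γ / K ^ ((3 / 2 : ℝ) * (m : ℝ) - 1 / 2)) := by
  have hK : 1 ≤ K := one_le_of_isNormalisedWuMapping hm (mem_ball_self one_pos) h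
  have hcov : CoversSchlichtBall (ball 0 1) F
      -- Any `r < 1` is allowed; `9/10` suffices to beat `3 / 50 / 2 ^ m` when `2 ^ m ≥ 2`.
      ((9 / 10) / (8 * (2 ^ m + 1) * K ^ (m - 1))) :=
    exists_schlicht_domain_of_wu hm finrank_euclideanSpace_fin (by linarith) h.1.1 h.1.2 h.2
      (by norm_num) (by norm_num)
  refine hcov.mono subset_rfl ?_
  have hm' : (1 : ℝ) ≤ m := by exact_mod_cast hm
  have hpow : K ^ (m - 1) ≤ K ^ ((3 / 2 : ℝ) * (m : ℝ) - 1 / 2) := by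
    rw [← Real.rpow_natCast, Nat.cast_sub hm]
    refine Real.rpow_le_rpow_of_exponent_le hK ?_
    push_cast
    linarith
  have h2m : (2 : ℝ) ≤ 2 ^ m := le_self_pow₀ one_le_two (by omega)
  calc explicitConst m σ γ / K ^ ((3 / 2 : ℝ) * (m : ℝ) - 1 / 2)
      ≤ 3 / 50 / 2 ^ m / K ^ (m - 1) := by
        gcongr
        exact explicitConst_le m hσ0 hσ1 hγ
    _ ≤ (9 / 10) / (8 * (2 ^ m + 1)) / K ^ (m - 1) := by
        refine div_le_div_of_nonneg_right ?_ (by positivity)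
        rw [div_le_div_iff₀ (by positivity) (by positivity)]
        linarith
    _ = _ := by rw [div_div]

theorem natCast_rpow_mul_le {m : ℕ} (hm : 1 ≤ m) {R : ℝ} (hR : 0 ≤ R) :
    (m : ℝ) ^ (-(1 / 2) : ℝ) * R ≤ R :=
  mul_le_of_le_one_left hR
    (Real.rpow_le_one_of_one_le_of_nonpos (by exact_mod_cast hm) (by norm_num))

end Constants

end BlochWu

theorem mainTheorem3 (m : ℕ) (hm : 1 ≤ m) :
    (∃ C : ℝ, 0 < C ∧
      (∀ (K : ℝ) (F : EuclideanSpace ℂ (Fin m) → EuclideanSpace ℂ (Fin m)),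
        BlochWu.IsNormalisedWuMapping K (BlochWu.polydisk 0 1) F →
        BlochWu.CoversSchlichtBall (BlochWu.polydisk 0 1) F
          (C / K ^ ((3 / 2 : ℝ) * (m : ℝ) - 1 / 2))) ∧
      (∀ (K : ℝ) (F : EuclideanSpace ℂ (Fin m) → EuclideanSpace ℂ (Fin m)),
        BlochWu.IsNormalisedWuMapping K (Metric.ball 0 1) F →
        BlochWu.CoversSchlichtBall (Metric.ball 0 1) F
          ((m : ℝ) ^ (-(1 / 2) : ℝ) * (C / K ^ ((3 / 2 : ℝ) * (m : ℝ) - 1 / 2))))) ∧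
    (∀ σ γ : ℝ, 0 < σ → σ < 1 → 1 < γ →
      0 < BlochWu.explicitConst m σ γ ∧
      (∀ (K : ℝ) (F : EuclideanSpace ℂ (Fin m) → EuclideanSpace ℂ (Fin m)),
        BlochWu.IsNormalisedWuMapping K (BlochWu.polydisk 0 1) F →
        BlochWu.CoversSchlichtBall (BlochWu.polydisk 0 1) F
          (BlochWu.explicitConst m σ γ / K ^ ((3 / 2 : ℝ) * (m : ℝ) - 1 / 2))) ∧
      (∀ (K : ℝ) (F : EuclideanSpace ℂ (Fin m) → EuclideanSpace ℂ (Fin m)),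
        BlochWu.IsNormalisedWuMapping K (Metric.ball 0 1) F →
        BlochWu.CoversSchlichtBall (Metric.ball 0 1) F
          ((m : ℝ) ^ (-(1 / 2) : ℝ) *
            (BlochWu.explicitConst m σ γ / K ^ ((3 / 2 : ℝ) * (m : ℝ) - 1 / 2))))) := by
  have main : ∀ σ γ : ℝ, 0 < σ → σ < 1 → 1 < γ →
      0 < BlochWu.explicitConst m σ γ ∧
      (∀ (K : ℝ) (F : EuclideanSpace ℂ (Fin m) → EuclideanSpace ℂ (Fin m)),
        BlochWu.IsNormalisedWuMapping K (BlochWu.polydisk 0 1) F →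
        BlochWu.CoversSchlichtBall (BlochWu.polydisk 0 1) F
          (BlochWu.explicitConst m σ γ / K ^ ((3 / 2 : ℝ) * (m : ℝ) - 1 / 2))) ∧
      (∀ (K : ℝ) (F : EuclideanSpace ℂ (Fin m) → EuclideanSpace ℂ (Fin m)),
        BlochWu.IsNormalisedWuMapping K (Metric.ball 0 1) F →
        BlochWu.CoversSchlichtBall (Metric.ball 0 1) F
          ((m : ℝ) ^ (-(1 / 2) : ℝ) *
            (BlochWu.explicitConst m σ γ / K ^ ((3 / 2 : ℝ) * (m : ℝ) - 1 / 2)))) := by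
    intro σ γ hσ0 hσ1 hγ
    have hpos := BlochWu.explicitConst_pos m hσ0 hσ1 hγ
    refine ⟨hpos, fun K F hF => ?_, fun K F hF => ?_⟩
    · exact ((hF.mono (BlochWu.ball_subset_polydisk m)).coversSchlichtBall hm hσ0 hσ1 hγ).mono
        (BlochWu.ball_subset_polydisk m) le_rfl
    · have hK := BlochWu.one_le_of_isNormalisedWuMapping hm (Metric.mem_ball_self one_pos) hF
      exact (hF.coversSchlichtBall hm hσ0 hσ1 hγ).mono subset_rfl
        (BlochWu.natCast_rpow_mul_le hm (by positivity))
  -- Any admissible `σ`, `γ` yield a constant depending only on `m`.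
  exact ⟨⟨_, main (1 / 2) 2 (by norm_num) (by norm_num) (by norm_num)⟩, main⟩
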